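/- Consider the discrete-time noncoherent multipath fading channel whose output at time $k\in\{1,2,\ldots\}$, for inputs $x_1,\ldots,x_k\in\mathbb{C}$, is $$Y_k=\sum_{\ell=0}^{k-1}H_k^{(\ell)}x_{k-\ell}+Z_k .$$ Here $\{Z_k\}$ is a sequence of IID zero-mean circularly-symmetric complex Gaussian random variables of variance $\sigma^2>0$. For each $\ell\ge 0$, the path gain $\{H_k^{(\ell)}\}_{k\ge1}$ is a zero-mean (not necessarily Gaussian) complex stationary process with variance $\alpha_\ell=\mathsf{E}\bigl[|H_k^{(\ell)}|^2\bigr]$ and differential entropy rate $h_\ell=\lim_{n\to\infty}\frac1n h\bigl(H_1^{(\ell)},\ldots,H_n^{(\ell)}\bigr)\in[-\infty,\infty)$, where the differential entropy of a law without a density is $-\infty$. Assume that $\alpha_0>0$, that $\sum_{\ell=0}^\infty\alpha_\ell<\infty$, and that $h_\ell>-\infty$ for every $\ell$ with $\alpha_\ell>0$ (which holds in particular if $\inf_{\ell:\alpha_\ell>0}h_\ell>-\infty$, or if $\inf_{\ell:\alpha_\ell>0}(h_\ell-\log\alpha_\ell)>-\infty$). Assume also that the processes $\{H_k^{(0)}\},\{H_k^{(1)}\},\ldots$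 are independent, that they are jointly independent of $\{Z_k\}$, and that the joint law of the path gains and the noise does not depend on the input. For $\mathrm{SNR}>0$ define $$C(\mathrm{SNR})=\liminf_{n\to\infty}\frac1n\sup I(X_1^n;Y_1^n),$$ where the supremum is over all joint distributions of $(X_1,\ldots,X_n)$, independent of the path gains and the noise, that satisfy $\frac1n\sum_{k=1}^n\mathsf{E}[|X_k|^2]\le \mathsf{P}$ with $\mathsf{P}=\mathrm{SNR}\cdot\sigma^2$. If $$\lim_{\ell\to\infty}\frac1\ell\log\frac1{\alpha_\ell}=\infty ,$$ where $1/0=\infty$, i.e. if the path variances decay faster than exponentially, then $$\sup_{\mathrm{SNR}>0}C(\mathrm{SNR})=\infty .$$ -/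

import Mathlib

open MeasureTheory ProbabilityTheory Filter Topology
open scoped NNReal ENNReal

noncomputable section

namespace Multipath

/-- The circularly-symmetric complex Gaussian law of mean zero and variance `v`: real and imaginary
parts are independent real Gaussians of variance `v / 2`. -/
def complexGaussian (v : ℝ≥0) : Measure ℂ :=
  ((gaussianReal 0 (v / 2)).prod (gaussianReal 0 (v / 2))).map Complex.measurableEquivRealProd.symm

/-- Differential entropy (in nats) of a law on a space with a reference (Lebesgue) measure:
`-∫ f log f` if the law has a density `f`, computed as positive part minus negative part,
and `-∞` if it has no density. -/
def diffEntropy {E : Type*} [MeasureSpace E] (μ : Measure E) : EReal :=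
  open Classical in
  if μ ≪ volume then
    ((∫⁻ x, ENNReal.ofReal (Real.negMulLog (μ.rnDeriv volume x).toReal) : ℝ≥0∞) : EReal) -
      ((∫⁻ x, ENNReal.ofReal (-Real.negMulLog (μ.rnDeriv volume x).toReal) : ℝ≥0∞) : EReal)
  else ⊥

/-- Mutual information (in nats) of a joint law: the relative entropy between the joint law and the
product of its marginals. -/
def mutualInfo {A B : Type*} [MeasurableSpace A] [MeasurableSpace B] (ρ : Measure (A × B)) :
    ℝ≥0∞ :=
  InformationTheory.klDiv ρ (ρ.fst.prod ρ.snd)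

variable {Ω : Type*} [MeasurableSpace Ω]

/-- Strict stationarity of a one-sided complex process. -/
def IsStationary (P : Measure Ω) (G : ℕ → Ω → ℂ) : Prop :=
  ∀ m : ℕ, IdentDistrib (fun ω k => G (k + m) ω) (fun ω k => G k ω) P P

/-- The second moment of a (stationary) process. -/
def pathVariance (P : Measure Ω) (G : ℕ → Ω → ℂ) : ℝ≥0∞ :=
  ∫⁻ ω, ‖G 0 ω‖ₑ ^ 2 ∂P

/-- The differential entropy rate `lim (1/n) h(G₁, …, Gₙ)`. For a stationary process of finite
variance the sequence is nonincreasing, so the limit exists in `[-∞, ∞)` and is the `limsup`. -/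
def entropyRate (P : Measure Ω) (G : ℕ → Ω → ℂ) : EReal :=
  limsup (fun n : ℕ => diffEntropy (P.map (fun ω (k : Fin n) => G k ω)) / (n : EReal)) atTop

/-- The outputs of the multipath channel at the first `n` time instants, for the input block `x`.
Time instants are numbered from zero; `H ℓ k` is the gain of path `ℓ` at time `k`. -/
def output (H : ℕ → ℕ → Ω → ℂ) (Z : ℕ → Ω → ℂ) (n : ℕ) (x : Fin n → ℂ) (ω : Ω) : Fin n → ℂ :=
  fun k => (∑ ℓ : Fin (k.val + 1), H ℓ k ω * x ⟨k.val - ℓ.val, by omega⟩) + Z k ω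

/-- The joint law of the input and output blocks when the input block has law `ν` and is independent
of the path gains and of the noise. -/
def jointLaw (P : Measure Ω) (H : ℕ → ℕ → Ω → ℂ) (Z : ℕ → Ω → ℂ) (n : ℕ)
    (ν : Measure (Fin n → ℂ)) : Measure ((Fin n → ℂ) × (Fin n → ℂ)) :=
  (ν.prod P).map (fun p => (p.1, output H Z n p.1 p.2))

/-- The input laws of block length `n` with average power at most `Pow`. -/
def admissibleInputs (n : ℕ) (Pow : ℝ≥0) : Set (Measure (Fin n → ℂ)) :=
  {ν | IsProbabilityMeasure ν ∧ (∑ k, ∫⁻ x, ‖x k‖ₑ ^ 2 ∂ν) / (n : ℝ≥0∞) ≤ (Pow : ℝ≥0∞)}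

/-- The information capacity `liminf (1/n) sup I(X₁ⁿ; Y₁ⁿ)` at transmit power `Pow`. -/
def capacity (P : Measure Ω) (H : ℕ → ℕ → Ω → ℂ) (Z : ℕ → Ω → ℂ) (Pow : ℝ≥0) : ℝ≥0∞ :=
  liminf (fun n : ℕ =>
    (⨆ ν ∈ admissibleInputs n Pow, mutualInfo (jointLaw P H Z n ν)) / (n : ℝ≥0∞)) atTop

end Multipath

end

namespace Multipath

/-! Transmit in bursts: `L` active instants, then `L` silent ones. Each active instant picks one of
`N` amplitudes, spaced by a factor `Γ` and lying above every amplitude used earlier in the burst.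
Interference from the current burst then has mean at most a fixed multiple of the preceding
amplitude scale, so by Markov's inequality the direct path usually dominates it. Earlier bursts
arrive only over delays greater than `L`, with amplitude at most `(Γ ^ N) ^ L`; superexponential
decay makes their mean contribution at most 1 for a suitable `L`, however large `Γ ^ N` is
(`exists_pow_mul_tsum_pathMean_le_one`).

Hence `|Y_k| / |X_k|` lies in a fixed interval with probability at least `q`
(`le_measure_output_mem_levelSet`), and the spacing `Γ` lets this interval single out the level. By
a variational bound, each active instant is worth at least `q * log (1 + N) - log 2` nats
(`le_mutualInfo_of_detection`). Since `q` and `Γ` do not depend on `N`, and at least half of the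
instants are active, the rate is unbounded in `N`. -/

/-! ### Variational lower bounds on mutual information -/

/-- A variational lower bound on the relative entropy. -/
theorem ofReal_integral_le_klDiv {α : Type*} [MeasurableSpace α] {μ ν : Measure α}
    [IsProbabilityMeasure μ] [IsProbabilityMeasure ν] {f : α → ℝ} (hf : Integrable f μ)
    (hexp : Integrable (fun x => Real.exp (f x)) ν) (hle : ∫ x, Real.exp (f x) ∂ν ≤ 1) :
    ENNReal.ofReal (∫ x, f x ∂μ) ≤ InformationTheory.klDiv μ ν := by
  by_cases htop : InformationTheory.klDiv μ ν = ⊤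
  · simp [htop]
  obtain ⟨hac, hint⟩ := InformationTheory.klDiv_ne_top_iff.1 htop
  have : IsProbabilityMeasure (ν.tilted f) := isProbabilityMeasure_tilted hexp
  -- Gibbs' inequality against the tilted measure: the divergence from `ν` is that from `ν.tilted f`
  -- plus `∫ f ∂μ - log ∫ exp f ∂ν`.
  have h0 := InformationTheory.integral_llr_add_sub_measure_univ_nonneg
    (hac.trans (absolutelyContinuous_tilted hexp))
    (integrable_llr_tilted_right hac hf hint hexp)
  rw [integral_llr_tilted_right hac hf hexp hint] at h0
  have hlog : Real.log (∫ x, Real.exp (f x) ∂ν) ≤ 0 :=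
    Real.log_nonpos (integral_nonneg fun x => (Real.exp_pos _).le) hle
  rw [InformationTheory.klDiv_of_ac_of_integrable hac hint]
  refine ENNReal.ofReal_le_ofReal ?_
  simp only [probReal_univ] at h0 ⊢
  linarith

/-- For an input with independent components, the mutual information is bounded from below by
the expected logarithmic score of any componentwise soft decoder. -/
theorem ofReal_integral_log_le_mutualInfo {ι A B : Type*} [Fintype ι] [MeasurableSpace A]
    [MeasurableSpace B] (ν : ι → Measure A) [∀ i, IsProbabilityMeasure (ν i)]
    (ρ : Measure ((ι → A) × (ι → B))) [IsProbabilityMeasure ρ] (hfst : ρ.fst = Measure.pi ν)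
    (g : ι → A × B → ℝ) (hg : ∀ i, Measurable (g i)) {c C : ℝ} (hc : 0 < c)
    (hcg : ∀ i p, c ≤ g i p) (hgC : ∀ i p, g i p ≤ C) (hone : ∀ i y, ∫ x, g i (x, y) ∂ν i ≤ 1) :
    ENNReal.ofReal (∫ p, ∑ i, Real.log (g i (p.1 i, p.2 i)) ∂ρ) ≤ mutualInfo ρ := by
  have hpos : ∀ i p, 0 < g i p := fun i p => hc.trans_le (hcg i p)
  have hcoord : ∀ i, Measurable (fun p : (ι → A) × (ι → B) => g i (p.1 i, p.2 i)) := fun i =>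
    (hg i).comp (by fun_prop)
  have hexp : ∀ p : (ι → A) × (ι → B),
      Real.exp (∑ i, Real.log (g i (p.1 i, p.2 i))) = ∏ i, g i (p.1 i, p.2 i) := fun p => by
    rw [Real.exp_sum]
    exact Finset.prod_congr rfl fun i _ => Real.exp_log (hpos i _)
  have hprod : Integrable (fun p : (ι → A) × (ι → B) => ∏ i, g i (p.1 i, p.2 i))
      (ρ.fst.prod ρ.snd) := by
    refine Integrable.of_bound (C := C ^ Fintype.card ι)
      (Finset.measurable_fun_prod _ fun i _ => hcoord i).aestronglyMeasurable
      (ae_of_all _ fun p => ?_)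
    rw [Real.norm_of_nonneg (Finset.prod_nonneg fun i _ => (hpos i _).le)]
    exact (Finset.prod_le_prod (fun i _ => (hpos i _).le) fun i _ => hgC i _).trans (by simp)
  refine ofReal_integral_le_klDiv ?_ ?_ ?_
  · refine integrable_finsetSum _ fun i _ => ?_
    refine Integrable.of_bound (C := max |Real.log c| |Real.log C|)
      (hcoord i).log.aestronglyMeasurable (ae_of_all _ fun p => ?_)
    exact abs_le_max_abs_abs (Real.log_le_log hc (hcg i _)) (Real.log_le_log (hpos i _) (hgC i _))
  · simpa only [hexp] using hprod
  · simp only [hexp]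
    rw [integral_prod_symm _ hprod]
    -- With the whole output block frozen, independence of the inputs alone factorizes the integral;
    -- the outputs may be dependent.
    have hle : ∀ y : ι → B, ∫ x, ∏ i, g i (x i, y i) ∂ρ.fst ≤ 1 := fun y => by
      rw [hfst, integral_fintype_prod_eq_prod (fun i x => g i (x, y i))]
      exact Finset.prod_le_one (fun i _ => integral_nonneg fun x => (hpos i _).le)
        fun i _ => hone i _
    calc ∫ y, ∫ x, ∏ i, g i (x i, y i) ∂ρ.fst ∂ρ.snd ≤ ∫ _, (1 : ℝ) ∂ρ.snd :=
          integral_mono hprod.integral_prod_right (integrable_const _) hle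
      _ = 1 := by simp

variable {Ω : Type*} [MeasurableSpace Ω]

/-! ### First moments of the paths and their decay -/

theorem tsum_eq_sum_range_add (f : ℕ → ℝ≥0∞) (N : ℕ) :
    ∑' i, f i = ∑ i ∈ Finset.range N, f i + ∑' i, f (i + N) :=
  (Summable.sum_add_tsum_nat_add' ENNReal.summable).symm

theorem IsStationary.identDistrib {P : Measure Ω} {G : ℕ → Ω → ℂ} (h : IsStationary P G) (k : ℕ) :
    IdentDistrib (G k) (G 0) P P := by
  simpa [Function.comp_def] using (h k).comp (u := fun f : ℕ → ℂ => f 0) (by fun_prop)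

/-- The absolute first moment of a (stationary) process. -/
noncomputable def pathMean (P : Measure Ω) (G : ℕ → Ω → ℂ) : ℝ≥0∞ :=
  ∫⁻ ω, ‖G 0 ω‖ₑ ∂P

theorem IsStationary.lintegral_enorm {P : Measure Ω} {G : ℕ → Ω → ℂ} (h : IsStationary P G)
    (k : ℕ) : ∫⁻ ω, ‖G k ω‖ₑ ∂P = pathMean P G :=
  ((h.identDistrib k).comp (u := fun z : ℂ => ‖z‖ₑ) (by fun_prop)).lintegral_eq

/-- Follows from `t ≤ 1 + t ^ 2`. The free scale `r` turns decay of variances into decay of first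
moments. -/
theorem mul_pathMean_le (P : Measure Ω) [IsProbabilityMeasure P] {G : ℕ → Ω → ℂ}
    (hG : ∀ k, Measurable (G k)) (r : ℝ≥0∞) :
    r * pathMean P G ≤ 1 + r ^ 2 * pathVariance P G := by
  have hm : Measurable fun ω => ‖G 0 ω‖ₑ := (hG 0).enorm
  have hpt : ∀ t : ℝ≥0∞, t ≤ 1 + t ^ 2 := fun t => by
    rcases le_total t 1 with h | h
    · exact h.trans le_self_add
    · exact (le_self_pow₀ h two_ne_zero).trans le_add_self
  calc r * pathMean P G = ∫⁻ ω, r * ‖G 0 ω‖ₑ ∂P := (lintegral_const_mul _ hm).symm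
    _ ≤ ∫⁻ ω, (1 + r ^ 2 * ‖G 0 ω‖ₑ ^ 2) ∂P :=
        lintegral_mono fun ω => (hpt _).trans (by rw [mul_pow])
    _ = 1 + r ^ 2 * pathVariance P G := by
        rw [lintegral_add_left measurable_const, lintegral_const_mul _ (hm.pow_const 2)]
        simp [pathVariance]

/-- Super-exponential decay in logarithmic form, rewritten multiplicatively. -/
theorem eventually_pow_mul_le_one {a : ℕ → ℝ≥0∞}
    (h : Tendsto (fun ℓ : ℕ => 1 / (ℓ : EReal) * ENNReal.log (1 / a ℓ)) atTop (𝓝 ⊤))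
    (K : ℕ) (hK : 1 ≤ K) : ∀ᶠ ℓ : ℕ in atTop, (K : ℝ≥0∞) ^ ℓ * a ℓ ≤ 1 := by
  have hK0 : (K : ℝ≥0∞) ≠ 0 := by exact_mod_cast (by omega : K ≠ 0)
  filter_upwards [h.eventually_const_lt (u := ENNReal.log (K : ℝ≥0∞)) (by simp),
    eventually_gt_atTop 0] with ℓ hℓ hpos
  have hpos' : (0 : EReal) < (ℓ : EReal) := by exact_mod_cast hpos
  have hne : (ℓ : EReal) ≠ ⊤ := EReal.natCast_ne_top ℓ
  have hlog : ENNReal.log ((K : ℝ≥0∞) ^ ℓ) ≤ ENNReal.log (1 / a ℓ) := by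
    rw [ENNReal.log_pow]
    have h1 : ENNReal.log (K : ℝ≥0∞) ≤ ENNReal.log (1 / a ℓ) / ℓ := by
      rw [EReal.div_eq_inv_mul]
      simpa [EReal.div_eq_inv_mul] using hℓ.le
    rw [mul_comm]
    exact (EReal.le_div_iff_mul_le hpos' hne).1 h1
  have hle := ENNReal.log_le_log_iff.1 hlog
  rw [one_div] at hle
  calc (K : ℝ≥0∞) ^ ℓ * a ℓ ≤ (a ℓ)⁻¹ * a ℓ := by gcongr
    _ ≤ 1 := ENNReal.inv_mul_le_one _

theorem tsum_pow_mul_pathMean_ne_top (P : Measure Ω) [IsProbabilityMeasure P]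
    {H : ℕ → ℕ → Ω → ℂ} (hH : ∀ ℓ k, Measurable (H ℓ k))
    (hfin : ∀ ℓ, pathVariance P (H ℓ) ≠ ⊤)
    (hdecay : Tendsto (fun ℓ : ℕ => 1 / (ℓ : EReal) * ENNReal.log (1 / pathVariance P (H ℓ)))
      atTop (𝓝 ⊤)) (K : ℕ) (hK : 1 ≤ K) :
    ∑' ℓ, (K : ℝ≥0∞) ^ ℓ * pathMean P (H ℓ) ≠ ⊤ := by
  -- The square accounts for passing from variances to first moments; the factor 2 leaves a
  -- geometric series.
  obtain ⟨N, hN⟩ := eventually_atTop.1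
    (eventually_pow_mul_le_one hdecay ((2 * K) ^ 2) (Nat.one_le_pow _ _ (by omega)))
  have hterm : ∀ ℓ, (K : ℝ≥0∞) ^ ℓ * pathMean P (H ℓ) ≠ ⊤ := fun ℓ =>
    ((mul_pathMean_le P (hH ℓ) _).trans_lt (ENNReal.add_lt_top.2 ⟨ENNReal.one_lt_top,
      ENNReal.mul_lt_top (by finiteness) (hfin ℓ).lt_top⟩)).ne
  have hgeom : ∀ ℓ, N ≤ ℓ → (K : ℝ≥0∞) ^ ℓ * pathMean P (H ℓ) ≤ 2 * (2⁻¹ : ℝ≥0∞) ^ ℓ := by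
    intro ℓ hℓ
    have h1 := mul_pathMean_le P (hH ℓ) ((2 * K : ℝ≥0∞) ^ ℓ)
    have h2 := hN ℓ hℓ
    push_cast at h2
    rw [pow_right_comm] at h2
    have h3 : (2 : ℝ≥0∞) ^ ℓ * ((K : ℝ≥0∞) ^ ℓ * pathMean P (H ℓ)) ≤ 2 := by
      calc (2 : ℝ≥0∞) ^ ℓ * ((K : ℝ≥0∞) ^ ℓ * pathMean P (H ℓ))
          = (2 * K : ℝ≥0∞) ^ ℓ * pathMean P (H ℓ) := by rw [mul_pow, mul_assoc]
        _ ≤ 1 + 1 := h1.trans (by gcongr)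
        _ = 2 := one_add_one_eq_two
    rw [← ENNReal.inv_pow, ← div_eq_mul_inv]
    exact (ENNReal.le_div_iff_mul_le (by simp) (by simp)).2 (by rwa [mul_comm])
  rw [tsum_eq_sum_range_add _ N]
  refine ENNReal.add_ne_top.2 ⟨ENNReal.sum_ne_top.2 fun ℓ _ => hterm ℓ, ?_⟩
  refine ne_top_of_le_ne_top ?_ (ENNReal.tsum_le_tsum fun ℓ => hgeom (ℓ + N) (by omega))
  refine ne_top_of_le_ne_top ?_ (ENNReal.tsum_comp_le_tsum_of_injective
    (add_left_injective N) (fun ℓ : ℕ => 2 * (2⁻¹ : ℝ≥0∞) ^ ℓ))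
  rw [ENNReal.tsum_mul_left, ENNReal.tsum_geometric]
  simp [ENNReal.mul_eq_top]

/-- Since `K ^ L ≤ K ^ (j + L)`, the left side is bounded by a tail of a convergent series. This
fixes the guard length once the peak amplitude per instant is known. -/
theorem exists_pow_mul_tsum_pathMean_le_one (P : Measure Ω) [IsProbabilityMeasure P]
    {H : ℕ → ℕ → Ω → ℂ} (hH : ∀ ℓ k, Measurable (H ℓ k))
    (hfin : ∀ ℓ, pathVariance P (H ℓ) ≠ ⊤)
    (hdecay : Tendsto (fun ℓ : ℕ => 1 / (ℓ : EReal) * ENNReal.log (1 / pathVariance P (H ℓ)))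
      atTop (𝓝 ⊤)) (K : ℕ) (hK : 1 ≤ K) :
    ∃ L : ℕ, 0 < L ∧ (K : ℝ≥0∞) ^ L * ∑' j, pathMean P (H (j + L)) ≤ 1 := by
  have ht := ENNReal.tendsto_sum_nat_add _ (tsum_pow_mul_pathMean_ne_top P hH hfin hdecay K hK)
  obtain ⟨L, hL, hpos⟩ := ((ht.eventually_le_const one_pos).and (eventually_gt_atTop 0)).exists
  refine ⟨L, hpos, le_trans ?_ hL⟩
  rw [← ENNReal.tsum_mul_left]
  refine ENNReal.tsum_le_tsum fun j => ?_
  gcongr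
  · exact_mod_cast hK
  · omega

/-! ### Interference and detection from the output magnitude -/

/-- The contribution of all but the direct path to the output at time `k`. -/
def interference {Ω : Type*} (H : ℕ → ℕ → Ω → ℂ) (n : ℕ) (x : Fin n → ℂ) (k : Fin n) (ω : Ω) : ℂ :=
  ∑ i : Fin k.val, H (i + 1) k ω * x ⟨k.val - (i.val + 1), by omega⟩

theorem output_eq {Ω : Type*} (H : ℕ → ℕ → Ω → ℂ) (Z : ℕ → Ω → ℂ) (n : ℕ) (x : Fin n → ℂ) (ω : Ω)
    (k : Fin n) : output H Z n x ω k = H 0 k ω * x k + interference H n x k ω + Z k ω := by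
  simp [output, interference, Fin.sum_univ_succ]

/-- `A` bounds the recent inputs, while the much larger `Q` is allowed only for inputs older than
`L`, so it meets only the tail of the path means. -/
theorem lintegral_interference_le (P : Measure Ω) {H : ℕ → ℕ → Ω → ℂ}
    (hH : ∀ ℓ k, Measurable (H ℓ k)) (hstat : ∀ ℓ, IsStationary P (H ℓ)) (n : ℕ) (x : Fin n → ℂ)
    (k : Fin n) (L : ℕ) (A Q : ℝ≥0∞)
    (hx : ∀ i : Fin n, i < k → ‖x i‖ₑ ≤ A + if i.val + L < k.val then Q else 0) :
    ∫⁻ ω, ‖interference H n x k ω‖ₑ ∂P ≤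
      A * ∑' ℓ, pathMean P (H ℓ) + Q * ∑' j, pathMean P (H (j + L)) := by
  set m : ℕ → ℝ≥0∞ := fun ℓ => pathMean P (H ℓ)
  have hmeas : ∀ ℓ, Measurable fun ω => ‖H ℓ k ω‖ₑ := fun ℓ => (hH ℓ k).enorm
  have htail : ∑' ℓ, (if L ≤ ℓ then Q * m ℓ else 0) = Q * ∑' j, m (j + L) := by
    rw [tsum_eq_sum_range_add _ L,
      Finset.sum_eq_zero fun i hi => if_neg (by simpa using hi), zero_add, ← ENNReal.tsum_mul_left]
    simp
  calc ∫⁻ ω, ‖interference H n x k ω‖ₑ ∂P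
      ≤ ∫⁻ ω, ∑ i : Fin k.val, ‖H (i + 1) k ω‖ₑ * ‖x ⟨k.val - (i.val + 1), by omega⟩‖ₑ ∂P :=
        lintegral_mono fun ω => (enorm_sum_le _ _).trans (by simp [enorm_mul])
    _ = ∑ i : Fin k.val, m (i + 1) * ‖x ⟨k.val - (i.val + 1), by omega⟩‖ₑ := by
        rw [lintegral_finsetSum _ fun i _ => (hmeas _).mul_const _]
        refine Finset.sum_congr rfl fun i _ => ?_
        rw [lintegral_mul_const _ (hmeas _), (hstat _).lintegral_enorm]
    _ ≤ ∑ i : Fin k.val, (A * m (i + 1) + if L ≤ i.val + 1 then Q * m (i + 1) else 0) := by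
        refine Finset.sum_le_sum fun i _ => ?_
        have hi := hx ⟨k.val - (i.val + 1), by omega⟩ 
          (Fin.lt_def.2 (Nat.sub_lt (Nat.zero_lt_of_lt i.isLt) (Nat.succ_pos _)))
        rw [mul_comm]
        refine (mul_le_mul_left hi _).trans ?_
        rw [add_mul]
        gcongr
        split_ifs with h1 h2
        · rfl
        · simp at h1; omega
        all_goals simp
    _ = ∑ i ∈ Finset.range k.val, (A * m (i + 1) + if L ≤ i + 1 then Q * m (i + 1) else 0) :=
        Fin.sum_univ_eq_sum_range
          (fun i => A * m (i + 1) + if L ≤ i + 1 then Q * m (i + 1) else 0) k.val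
    _ ≤ ∑' i, (A * m (i + 1) + if L ≤ i + 1 then Q * m (i + 1) else 0) := ENNReal.sum_le_tsum _
    _ ≤ ∑' ℓ, (A * m ℓ + if L ≤ ℓ then Q * m ℓ else 0) :=
        ENNReal.tsum_comp_le_tsum_of_injective (add_left_injective 1)
          (fun ℓ => A * m ℓ + if L ≤ ℓ then Q * m ℓ else 0)
    _ = _ := by rw [ENNReal.tsum_add, ENNReal.tsum_mul_left, htail]

/-- The event, for an input symbol `x` and an output symbol `y`, that `|y|` is comparable to
`|x|`. -/
def levelSet (a b : ℝ) : Set (ℂ × ℂ) :=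
  {p | a * ‖p.1‖ ≤ ‖p.2‖ ∧ ‖p.2‖ < b * ‖p.1‖}

theorem measurableSet_levelSet (a b : ℝ) : MeasurableSet (levelSet a b) := by
  have h1 : Measurable fun p : ℂ × ℂ => ‖p.1‖ := by fun_prop
  have h2 : Measurable fun p : ℂ × ℂ => ‖p.2‖ := by fun_prop
  exact (measurableSet_le (h1.const_mul a) h2).inter (measurableSet_lt h2 (h1.const_mul b))

/-- Unless the interference or the noise is large, they total less than `2 * A * R ≤ δ / 2 * ‖x‖`.
Of the probability `3 * q`, these two exceptional events cost `q` each. -/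
theorem le_measure_levelSet (P : Measure Ω) {h w z : Ω → ℂ} {x : ℂ} {δ D R A Γ : ℝ}
    {q : ℝ≥0∞} (hq : q ≠ ⊤) (hδ : 0 < δ) (hA : 1 ≤ A) (hΓ : 4 * R ≤ δ * Γ) (hR : 0 < R)
    (hx : Γ * A ≤ ‖x‖) (hgood : 3 * q ≤ P {ω | δ ≤ ‖h ω‖ ∧ ‖h ω‖ ≤ D})
    (hw : P {ω | A * R ≤ ‖w ω‖} ≤ q) (hz : P {ω | R ≤ ‖z ω‖} ≤ q) :
    q ≤ P {ω | (x, h ω * x + w ω + z ω) ∈ levelSet (δ / 2) (D + δ)} := by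
  have hsub : {ω | δ ≤ ‖h ω‖ ∧ ‖h ω‖ ≤ D} ⊆
      {ω | (x, h ω * x + w ω + z ω) ∈ levelSet (δ / 2) (D + δ)} ∪
        ({ω | A * R ≤ ‖w ω‖} ∪ {ω | R ≤ ‖z ω‖}) := by
    rintro ω ⟨h1, h2⟩
    by_contra hcon
    simp only [Set.mem_union, Set.mem_ofPred_eq, not_or, not_le] at hcon
    obtain ⟨hl, hw', hz'⟩ := hcon
    refine hl ?_
    have hz'' : ‖z ω‖ < A * R := hz'.trans_le (by nlinarith)
    have hAR : 4 * (A * R) ≤ δ * ‖x‖ := by nlinarith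
    have hwz : ‖w ω + z ω‖ < δ / 2 * ‖x‖ := (norm_add_le _ _).trans_lt (by linarith)
    have hhx : ‖h ω * x‖ = ‖h ω‖ * ‖x‖ := norm_mul _ _
    have h1' := mul_le_mul_of_nonneg_right h1 (norm_nonneg x)
    have h2' := mul_le_mul_of_nonneg_right h2 (norm_nonneg x)
    have hx0 : 0 ≤ δ / 2 * ‖x‖ := by positivity
    constructor
    · have := norm_sub_le_norm_add (h ω * x) (w ω + z ω)
      simp only [add_assoc]
      linarith
    · have := norm_add_le (h ω * x) (w ω + z ω)
      simp only [add_assoc]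
      linarith
  have hle := hgood.trans ((measure_mono hsub).trans
    ((measure_union_le _ _).trans (add_le_add le_rfl ((measure_union_le _ _).trans
      (add_le_add hw hz)))))
  have h3 : 3 * q = q + (q + q) := by ring
  rw [h3] at hle
  exact (ENNReal.add_le_add_iff_right (ENNReal.add_ne_top.2 ⟨hq, hq⟩)).1 hle

theorem exists_pos_measure_norm_mem (P : Measure Ω) {G : ℕ → Ω → ℂ}
    (hpos : 0 < pathVariance P G) :
    ∃ δ D : ℝ, 0 < δ ∧ 0 < P {ω | δ ≤ ‖G 0 ω‖ ∧ ‖G 0 ω‖ ≤ D} := by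
  by_contra! hcon
  refine hpos.ne' (lintegral_eq_zero_of_ae_eq_zero ?_)
  -- These annuli exhaust the punctured plane; if all were null, the process would vanish almost
  -- surely at time 0.
  have hnull : ∀ n : ℕ, ∀ᵐ ω ∂P, ¬ (1 / ((n : ℝ) + 1) ≤ ‖G 0 ω‖ ∧ ‖G 0 ω‖ ≤ (n : ℝ) + 1) := by
    intro n
    rw [ae_iff]
    simpa using hcon (1 / ((n : ℝ) + 1)) ((n : ℝ) + 1) (by positivity)
  filter_upwards [ae_all_iff.2 hnull] with ω hω
  by_contra hne
  have hG : 0 < ‖G 0 ω‖ := by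
    rw [norm_pos_iff]
    rintro h
    simp [h] at hne
  obtain ⟨a, ha⟩ := exists_nat_one_div_lt hG
  obtain ⟨b, hb⟩ := exists_nat_ge ‖G 0 ω‖
  refine hω (max a b) ⟨le_trans ?_ ha.le, hb.trans ?_⟩
  · gcongr
    exact le_max_left a b
  · have : (b : ℝ) ≤ (max a b : ℕ) := by exact_mod_cast le_max_right a b
    linarith

theorem exists_measure_norm_ge_le (P : Measure Ω) [IsProbabilityMeasure P] {z : Ω → ℂ}
    (hz : Measurable z) {q : ℝ≥0∞} (hq : 0 < q) :
    ∃ R : ℝ, 0 < R ∧ ∀ R' ≥ R, P {ω | R' ≤ ‖z ω‖} ≤ q := by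
  have ht : Tendsto (fun n : ℕ => P {ω | (n : ℝ) ≤ ‖z ω‖}) atTop
      (𝓝 (P (⋂ n : ℕ, {ω | (n : ℝ) ≤ ‖z ω‖}))) :=
    tendsto_measure_iInter_atTop
      (fun n => (measurableSet_le measurable_const hz.norm).nullMeasurableSet)
      (fun m n hmn ω (hω : (n : ℝ) ≤ ‖z ω‖) => le_trans (by exact_mod_cast hmn) hω)
      ⟨0, by finiteness⟩
  have hempty : (⋂ n : ℕ, {ω | (n : ℝ) ≤ ‖z ω‖}) = ∅ := by
    refine Set.eq_empty_of_forall_notMem fun ω hω => ?_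
    obtain ⟨n, hn⟩ := exists_nat_gt ‖z ω‖
    exact absurd (Set.mem_iInter.1 hω n) (not_le.2 hn)
  rw [hempty, measure_empty] at ht
  obtain ⟨n, hn, hpos⟩ := ((ht.eventually_le_const hq).and (eventually_gt_atTop 0)).exists
  exact ⟨n, by exact_mod_cast hpos, fun R' hR' => (measure_mono fun ω hω => hR'.trans hω).trans hn⟩

/-! ### The burst input distribution -/

/-- The amplitude of level `j` at time `k`. Time is divided into periods of length `2 * L`; in the
first half of a period the amplitudes grow, each time instant having `N` levels above all earlier
ones, and in the second half the transmitter is silent. -/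
def amplitude (Γ L N k : ℕ) (j : Fin N) : ℂ :=
  if k % (2 * L) < L then ((Γ ^ (N * (k % (2 * L)) + j + 1) : ℕ) : ℂ) else 0

/-- The law of an input symbol: all levels are equally likely. -/
noncomputable def symbolLaw (Γ L N k : ℕ) [NeZero N] : Measure ℂ :=
  (PMF.uniformOfFintype (Fin N)).toMeasure.map (amplitude Γ L N k)

instance (Γ L N k : ℕ) [NeZero N] : IsProbabilityMeasure (symbolLaw Γ L N k) :=
  Measure.isProbabilityMeasure_map (measurable_of_finite _).aemeasurable

theorem ae_symbolLaw (Γ L N k : ℕ) [NeZero N] :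
    ∀ᵐ x ∂symbolLaw Γ L N k, ∃ j, x = amplitude Γ L N k j := by
  filter_upwards [ae_map_mem_range (amplitude Γ L N k) (Set.finite_range _).measurableSet
    (PMF.uniformOfFintype (Fin N)).toMeasure] with x hx
  exact hx.imp fun j hj => hj.symm

theorem integral_symbolLaw (Γ L N k : ℕ) [NeZero N] {f : ℂ → ℝ} (hf : Measurable f) :
    ∫ x, f x ∂symbolLaw Γ L N k = (N : ℝ)⁻¹ * ∑ j, f (amplitude Γ L N k j) := by
  rw [symbolLaw, integral_map (measurable_of_finite _).aemeasurable hf.aestronglyMeasurable,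
    PMF.integral_eq_sum, Finset.mul_sum]
  simp

theorem enorm_complex_natCast (m : ℕ) : ‖(m : ℂ)‖ₑ = m := by
  rw [← ofReal_norm, Complex.norm_natCast, ENNReal.ofReal_natCast]

theorem enorm_amplitude_le (Γ L N k : ℕ) (hΓ : 1 ≤ Γ) (j : Fin N) :
    ‖amplitude Γ L N k j‖ₑ ≤ ((Γ ^ (N * L) : ℕ) : ℝ≥0∞) := by
  unfold amplitude
  split_ifs with h
  · have hexp : N * (k % (2 * L)) + j + 1 ≤ N * L := by
      have h1 : N * (k % (2 * L) + 1) ≤ N * L := Nat.mul_le_mul_left _ h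
      have := j.isLt
      rw [mul_add] at h1
      omega
    rw [enorm_complex_natCast]
    exact_mod_cast Nat.pow_le_pow_right hΓ hexp
  · simp

/-- The silent half acts as a guard interval: an active instant at most `L` back belongs to the same
period, so its levels lie below those of position `k % (2 * L)`. -/
theorem enorm_amplitude_le_of_lt (Γ L N : ℕ) (hΓ : 1 ≤ Γ) {i k : ℕ} (hik : i < k)
    (hkL : k ≤ i + L) (j : Fin N) :
    ‖amplitude Γ L N i j‖ₑ ≤ ((Γ ^ (N * (k % (2 * L))) : ℕ) : ℝ≥0∞) := by
  unfold amplitude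
  split_ifs with h
  · have hlt : i % (2 * L) < k % (2 * L) := by
      have hi := Nat.div_add_mod i (2 * L)
      have hk' := Nat.div_add_mod k (2 * L)
      by_contra hcon
      push Not at hcon
      have hq : i / (2 * L) < k / (2 * L) := by
        by_contra hq
        have := Nat.mul_le_mul_left (2 * L) (not_lt.1 hq)
        omega
      have := Nat.mul_le_mul_left (2 * L) (Nat.succ_le_of_lt hq)
      rw [Nat.mul_succ] at this
      omega
    have hexp : N * (i % (2 * L)) + j + 1 ≤ N * (k % (2 * L)) := by
      have h1 : N * (i % (2 * L) + 1) ≤ N * (k % (2 * L)) := Nat.mul_le_mul_left _ hlt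
      have := j.isLt
      rw [mul_add] at h1
      omega
    rw [enorm_complex_natCast]
    exact_mod_cast Nat.pow_le_pow_right hΓ hexp
  · simp

/-- A given output symbol is compatible with at most one level. -/
theorem sum_indicator_levelSet_le_one {a b : ℝ} {Γ L N k : ℕ} (ha : 0 < a) (hb : b ≤ a * Γ)
    (hΓ : 1 ≤ Γ) (hk : k % (2 * L) < L) (y : ℂ) :
    ∑ j : Fin N, (levelSet a b).indicator (1 : ℂ × ℂ → ℝ) (amplitude Γ L N k j, y) ≤ 1 := by
  classical
  have hnorm : ∀ j : Fin N,
      ‖amplitude Γ L N k j‖ = (Γ : ℝ) ^ (N * (k % (2 * L)) + j + 1) := fun j => by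
    simp [amplitude, hk]
  have hΓ' : (1 : ℝ) ≤ Γ := by exact_mod_cast hΓ
  have hlt : ∀ i j : Fin N, (amplitude Γ L N k i, y) ∈ levelSet a b →
      (amplitude Γ L N k j, y) ∈ levelSet a b → ¬ i < j := by
    rintro i j ⟨-, hi⟩ ⟨hj, -⟩ hij
    simp only [hnorm] at hi hj
    have hpow : (Γ : ℝ) * (Γ : ℝ) ^ (N * (k % (2 * L)) + i + 1) ≤
        (Γ : ℝ) ^ (N * (k % (2 * L)) + j + 1) := by
      rw [← pow_succ']
      exact pow_le_pow_right₀ hΓ' (by have := Fin.lt_def.1 hij; omega)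
    have h1 := mul_le_mul_of_nonneg_left hpow ha.le
    have h2 := mul_le_mul_of_nonneg_right hb
      (by positivity : (0 : ℝ) ≤ (Γ : ℝ) ^ (N * (k % (2 * L)) + i + 1))
    linarith
  simp only [Set.indicator_apply, Pi.one_apply, Finset.sum_boole]
  norm_cast
  refine Finset.card_le_one.2 fun i hi j hj => ?_
  simp only [Finset.mem_filter, Finset.mem_univ, true_and] at hi hj
  exact le_antisymm (not_lt.1 (hlt j i hj hi)) (not_lt.1 (hlt i j hi hj))

/-! ### The soft decoder and its score -/

/-- The score of the pair consisting of the input and output symbols at time `k`. -/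
noncomputable def score (a b : ℝ) (L N k : ℕ) (p : ℂ × ℂ) : ℝ :=
  if k % (2 * L) < L then (1 + N * (levelSet a b).indicator 1 p) / 2 else 1

theorem measurable_score (a b : ℝ) (L N k : ℕ) : Measurable (score a b L N k) := by
  unfold score
  split_ifs
  · exact (((measurable_one.indicator (measurableSet_levelSet a b)).const_mul _).const_add
      _).div_const _
  · exact measurable_const

theorem half_le_score (a b : ℝ) (L N k : ℕ) (p : ℂ × ℂ) : 1 / 2 ≤ score a b L N k p := by
  unfold score
  split_ifs
  · have : 0 ≤ (N : ℝ) * (levelSet a b).indicator (1 : ℂ × ℂ → ℝ) p :=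
      mul_nonneg (by positivity) (Set.indicator_nonneg (fun _ _ => zero_le_one) _)
    linarith
  · norm_num

theorem score_le (a b : ℝ) (L N k : ℕ) (p : ℂ × ℂ) : score a b L N k p ≤ 1 + N := by
  unfold score
  have hN : (0 : ℝ) ≤ N := by positivity
  split_ifs
  · by_cases hp : p ∈ levelSet a b
    · simp only [Set.indicator_of_mem hp, Pi.one_apply]
      linarith
    · simp only [Set.indicator_of_notMem hp]
      linarith
  · linarith

/-- At most one of the `N` equiprobable levels fits `y`, so the indicator term averages at most 1.
Mixing it with the constant 1 keeps the logarithm bounded below, at the price of `log 2`. -/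
theorem integral_score_le_one {a b : ℝ} {Γ L N : ℕ} [NeZero N] (k : ℕ) (ha : 0 < a)
    (hb : b ≤ a * Γ) (hΓ : 1 ≤ Γ) (y : ℂ) :
    ∫ x, score a b L N k (x, y) ∂symbolLaw Γ L N k ≤ 1 := by
  by_cases hk : k % (2 * L) < L
  · have hN : (0 : ℝ) < N := by exact_mod_cast Nat.pos_of_ne_zero (NeZero.ne N)
    have hmeas : Measurable fun x : ℂ => score a b L N k (x, y) :=
      (measurable_score a b L N k).comp measurable_prodMk_right
    rw [integral_symbolLaw Γ L N k hmeas]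
    simp only [score, if_pos hk]
    rw [← Finset.sum_div, Finset.sum_add_distrib, ← Finset.mul_sum]
    have := sum_indicator_levelSet_le_one (N := N) ha hb hΓ hk y
    rw [inv_mul_le_iff₀ hN]
    simp only [Finset.sum_const, Finset.card_univ, Fintype.card_fin, nsmul_eq_mul, mul_one]
    nlinarith
  · simp [score, hk]

theorem log_score_eq (a b : ℝ) {L N k : ℕ} (hk : k % (2 * L) < L) (p : ℂ × ℂ) :
    Real.log (score a b L N k p) =
      (levelSet a b).indicator 1 p * Real.log (1 + N) - Real.log 2 := by
  have hN : (0 : ℝ) ≤ N := by positivity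
  by_cases hp : p ∈ levelSet a b
  · simp only [score, if_pos hk, Set.indicator_of_mem hp, Pi.one_apply, mul_one, one_mul]
    rw [Real.log_div (by positivity) two_ne_zero]
  · simp [score, hk, Set.indicator_of_notMem hp]

/-- Shifting back by `L` injects the silent instants into the active ones, even when the last period
is truncated. -/
theorem half_le_card_active (n L : ℕ) (hL : 0 < L) :
    n ≤ 2 * (Finset.univ.filter fun k : Fin n => k.val % (2 * L) < L).card := by
  have hcompl : (Finset.univ.filter fun k : Fin n => ¬ k.val % (2 * L) < L).card ≤
      (Finset.univ.filter fun k : Fin n => k.val % (2 * L) < L).card := by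
    have hle : ∀ k : ℕ, ¬ k % (2 * L) < L → L ≤ k := fun k hk =>
      (not_lt.1 hk).trans (Nat.mod_le _ _)
    refine Finset.card_le_card_of_injOn (fun k => ⟨k.val - L, by omega⟩) ?_ ?_
    · intro k hk
      simp only [Finset.coe_filter, Finset.mem_univ, true_and, Set.mem_ofPred_eq] at hk ⊢
      have h1 := Nat.div_add_mod k.val (2 * L)
      have h2 := Nat.mod_lt k.val (by omega : 0 < 2 * L)
      have h3 : k.val - L = (k.val % (2 * L) - L) + 2 * L * (k.val / (2 * L)) := by omega
      rw [h3, Nat.add_mul_mod_self_left, Nat.mod_eq_of_lt (by omega)]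
      omega
    · intro i hi j hj hij
      simp only [Finset.coe_filter, Finset.mem_univ, true_and, Set.mem_ofPred_eq] at hi hj
      have h1 := hle _ hi
      have h2 := hle _ hj
      simp only [Fin.mk.injEq] at hij
      exact Fin.ext (by omega)
  have := Finset.card_filter_add_card_filter_not (s := (Finset.univ : Finset (Fin n)))
    (fun k : Fin n => k.val % (2 * L) < L)
  simp only [Finset.card_univ, Fintype.card_fin] at this
  omega

/-! ### Mutual information and power of the burst scheme -/

theorem measurable_output {H : ℕ → ℕ → Ω → ℂ} {Z : ℕ → Ω → ℂ} (hH : ∀ ℓ k, Measurable (H ℓ k))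
    (hZ : ∀ k, Measurable (Z k)) (n : ℕ) :
    Measurable fun p : (Fin n → ℂ) × Ω => output H Z n p.1 p.2 := by
  unfold output
  fun_prop

theorem fst_jointLaw (P : Measure Ω) [IsProbabilityMeasure P] {H : ℕ → ℕ → Ω → ℂ}
    {Z : ℕ → Ω → ℂ} (hH : ∀ ℓ k, Measurable (H ℓ k)) (hZ : ∀ k, Measurable (Z k)) (n : ℕ)
    (ν : Measure (Fin n → ℂ)) [IsProbabilityMeasure ν] : (jointLaw P H Z n ν).fst = ν := by
  rw [jointLaw, Measure.fst_map_prodMk (measurable_output hH hZ n)]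
  exact Measure.fst_prod

/-- If every active symbol is detected with probability at least `q`, then each active symbol
contributes at least `q * log (1 + N) - log 2` to the mutual information. -/
theorem le_mutualInfo_of_detection (P : Measure Ω) [IsProbabilityMeasure P]
    {H : ℕ → ℕ → Ω → ℂ} {Z : ℕ → Ω → ℂ} (hH : ∀ ℓ k, Measurable (H ℓ k))
    (hZ : ∀ k, Measurable (Z k)) {a b q : ℝ} {Γ L N : ℕ} [NeZero N] (hL : 0 < L) (ha : 0 < a)
    (hb : b ≤ a * Γ) (hΓ : 1 ≤ Γ) (hrate : 0 ≤ q * Real.log (1 + N) - Real.log 2) (n : ℕ)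
    (hdet : ∀ x : Fin n → ℂ, (∀ i, ∃ j, x i = amplitude Γ L N i j) → ∀ k : Fin n,
      k.val % (2 * L) < L →
        ENNReal.ofReal q ≤ P {ω | (x k, output H Z n x ω k) ∈ levelSet a b}) :
    ENNReal.ofReal (n / 2 * (q * Real.log (1 + N) - Real.log 2)) ≤
      mutualInfo (jointLaw P H Z n (Measure.pi fun k : Fin n => symbolLaw Γ L N k)) := by
  set ν : Measure (Fin n → ℂ) := Measure.pi fun k : Fin n => symbolLaw Γ L N k
  have hjoint : Measurable fun p : (Fin n → ℂ) × Ω => (p.1, output H Z n p.1 p.2) :=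
    measurable_fst.prodMk (measurable_output hH hZ n)
  have : IsProbabilityMeasure (jointLaw P H Z n ν) :=
    Measure.isProbabilityMeasure_map hjoint.aemeasurable
  have hlogN : 0 ≤ Real.log (1 + N) := Real.log_nonneg (by simp)
  have hae : ∀ᵐ x ∂ν, ∀ i : Fin n, ∃ j, x i = amplitude Γ L N i j :=
    eventually_all.2 fun i => (Measure.tendsto_eval_ae_ae
      (μ := fun k : Fin n => symbolLaw Γ L N k)).eventually (ae_symbolLaw Γ L N i)
  have hset : ∀ k : Fin n, MeasurableSet
      {p : (Fin n → ℂ) × (Fin n → ℂ) | (p.1 k, p.2 k) ∈ levelSet a b} := fun k =>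
    (by fun_prop : Measurable fun p : (Fin n → ℂ) × (Fin n → ℂ) => (p.1 k, p.2 k))
      (measurableSet_levelSet a b)
  have hprob : ∀ k : Fin n, k.val % (2 * L) < L →
      q ≤ (jointLaw P H Z n ν).real {p | (p.1 k, p.2 k) ∈ levelSet a b} := by
    intro k hk
    refine (ENNReal.ofReal_le_iff_le_toReal (measure_ne_top _ _)).1 ?_
    rw [jointLaw, Measure.map_apply hjoint (hset k), Measure.prod_apply (hjoint (hset k))]
    calc ENNReal.ofReal q = ∫⁻ _, ENNReal.ofReal q ∂ν := by simp
      _ ≤ _ := lintegral_mono_ae (hae.mono fun x hx => hdet x hx k hk)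
  have hint : ∀ k : Fin n, Integrable
      (fun p : (Fin n → ℂ) × (Fin n → ℂ) => Real.log (score a b L N k (p.1 k, p.2 k)))
      (jointLaw P H Z n ν) := fun k => by
    refine Integrable.of_bound (C := max |Real.log (1 / 2)| |Real.log (1 + N)|)
      ((measurable_score a b L N k).comp (by fun_prop)).log.aestronglyMeasurable
      (ae_of_all _ fun p => ?_)
    have h := half_le_score a b L N k (p.1 k, p.2 k)
    exact abs_le_max_abs_abs (Real.log_le_log (by norm_num) h)
      (Real.log_le_log (by linarith) (score_le a b L N k _))
  refine le_trans (ENNReal.ofReal_le_ofReal ?_)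
    (ofReal_integral_log_le_mutualInfo (fun k : Fin n => symbolLaw Γ L N k) (jointLaw P H Z n ν)
      (fst_jointLaw P hH hZ n ν) (fun k => score a b L N k) (fun k => measurable_score a b L N k)
      one_half_pos (fun k => half_le_score a b L N k) (fun k => score_le a b L N k)
      (fun k y => integral_score_le_one k ha hb hΓ y))
  rw [integral_finsetSum _ fun k _ => hint k]
  have hterm : ∀ k : Fin n, (if k.val % (2 * L) < L then q * Real.log (1 + N) - Real.log 2 else 0)
      ≤ ∫ p, Real.log (score a b L N k (p.1 k, p.2 k)) ∂jointLaw P H Z n ν := by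
    intro k
    split_ifs with hk
    · simp only [log_score_eq a b hk]
      have hind : (fun p : (Fin n → ℂ) × (Fin n → ℂ) =>
          (levelSet a b).indicator (1 : ℂ × ℂ → ℝ) (p.1 k, p.2 k)) =
          {p : (Fin n → ℂ) × (Fin n → ℂ) | (p.1 k, p.2 k) ∈ levelSet a b}.indicator 1 := rfl
      have hi : Integrable (fun p : (Fin n → ℂ) × (Fin n → ℂ) =>
          (levelSet a b).indicator (1 : ℂ × ℂ → ℝ) (p.1 k, p.2 k)) (jointLaw P H Z n ν) := by
        rw [hind]
        exact (integrable_const (1 : ℝ)).indicator (hset k)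
      rw [integral_sub (hi.mul_const _) (integrable_const _), integral_mul_const, hind,
        integral_indicator_one (hset k)]
      simp only [integral_const, probReal_univ, one_smul]
      have := mul_le_mul_of_nonneg_right (hprob k hk) hlogN
      linarith
    · simp [score, hk]
  refine le_trans ?_ (Finset.sum_le_sum fun k _ => hterm k)
  rw [← Finset.sum_filter, Finset.sum_const, nsmul_eq_mul]
  have hcard : (n : ℝ) ≤ 2 * (Finset.univ.filter fun k : Fin n => k.val % (2 * L) < L).card := by
    exact_mod_cast half_le_card_active n L hL
  exact mul_le_mul_of_nonneg_right (by linarith) hrate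

theorem pi_symbolLaw_mem_admissibleInputs (Γ L N n : ℕ) [NeZero N] (hΓ : 1 ≤ Γ) :
    Measure.pi (fun k : Fin n => symbolLaw Γ L N k) ∈
      admissibleInputs n (((Γ ^ (N * L)) ^ 2 : ℕ) : ℝ≥0) := by
  refine ⟨inferInstance, ENNReal.div_le_of_le_mul ?_⟩
  have hle : ∀ k : Fin n, ∫⁻ x, ‖x k‖ₑ ^ 2 ∂Measure.pi (fun k : Fin n => symbolLaw Γ L N k) ≤
      (((Γ ^ (N * L)) ^ 2 : ℕ) : ℝ≥0∞) := fun k => by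
    have hae := (Measure.tendsto_eval_ae_ae (μ := fun k : Fin n => symbolLaw Γ L N k)
      (i := k)).eventually (ae_symbolLaw Γ L N k)
    refine (lintegral_mono_ae (g := fun _ => (((Γ ^ (N * L)) ^ 2 : ℕ) : ℝ≥0∞))
      (hae.mono fun x hx => ?_)).trans (by simp)
    obtain ⟨j, hj⟩ := hx
    simp only [Function.eval] at hj
    rw [hj, Nat.cast_pow (Γ ^ (N * L))]
    gcongr
    exact enorm_amplitude_le Γ L N k hΓ j
  refine (Finset.sum_le_sum fun k _ => hle k).trans ?_
  simp [mul_comm]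

/-! ### Detection probability and choice of constants -/

/-- Reliable detection of the active symbols, provided that the paths beyond the guard interval
are weak enough. -/
theorem le_measure_output_mem_levelSet (P : Measure Ω)
    {H : ℕ → ℕ → Ω → ℂ} {Z : ℕ → Ω → ℂ} (hH : ∀ ℓ k, Measurable (H ℓ k))
    (hstat : ∀ ℓ, IsStationary P (H ℓ)) {δ D R : ℝ} {q : ℝ≥0∞} (hq : q ≠ ⊤)
    (hδ : 0 < δ) (hR : 0 < R) (hgood : 3 * q ≤ P {ω | δ ≤ ‖H 0 0 ω‖ ∧ ‖H 0 0 ω‖ ≤ D})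
    (hz : ∀ k, P {ω | R ≤ ‖Z k ω‖} ≤ q)
    (hRq : ∑' ℓ, pathMean P (H ℓ) + 1 ≤ q * ENNReal.ofReal R) {Γ L N : ℕ} (hΓ : 1 ≤ Γ)
    (hΓR : 4 * R ≤ δ * Γ)
    (htail : ((Γ ^ N : ℕ) : ℝ≥0∞) ^ L * ∑' j, pathMean P (H (j + L)) ≤ 1) {n : ℕ}
    (x : Fin n → ℂ) (hx : ∀ i, ∃ j, x i = amplitude Γ L N i j) (k : Fin n)
    (hk : k.val % (2 * L) < L) :
    q ≤ P {ω | (x k, output H Z n x ω k) ∈ levelSet (δ / 2) (D + δ)} := by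
  set A : ℕ := Γ ^ (N * (k.val % (2 * L))) with hA
  have hA1 : 1 ≤ A := Nat.one_le_pow _ _ hΓ
  have hinterf : ∫⁻ ω, ‖interference H n x k ω‖ₑ ∂P ≤
      A * (∑' ℓ, pathMean P (H ℓ) + 1) := by
    refine (lintegral_interference_le P hH hstat n x k L A ((Γ ^ N : ℕ) ^ L) ?_).trans ?_
    · intro i hik
      obtain ⟨j, hj⟩ := hx i
      rw [hj]
      split_ifs with h
      · refine (enorm_amplitude_le Γ L N i hΓ j).trans (le_add_left ?_)
        rw [pow_mul]
        push_cast
        exact le_rfl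
      · exact (enorm_amplitude_le_of_lt Γ L N hΓ (Fin.lt_def.1 hik) (by omega) j).trans
          le_self_add
    · rw [mul_add, mul_one]
      gcongr
      exact htail.trans (by exact_mod_cast hA1)
  have hmeas : Measurable fun ω => ‖interference H n x k ω‖ₑ := by
    unfold interference
    fun_prop
  -- Markov's inequality: threshold and mean bound both scale with `A`, so the bound is uniform in
  -- the position within the burst.
  have hw : P {ω | (A : ℝ) * R ≤ ‖interference H n x k ω‖} ≤ q := by
    have hset : {ω | (A : ℝ) * R ≤ ‖interference H n x k ω‖} =
        {ω | ENNReal.ofReal (A * R) ≤ ‖interference H n x k ω‖ₑ} := by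
      ext ω
      simp only [Set.mem_ofPred_eq, ← ofReal_norm,
        ENNReal.ofReal_le_ofReal_iff (norm_nonneg _)]
    have hAR : (0 : ℝ) < A * R := mul_pos (by exact_mod_cast hA1) hR
    rw [hset]
    refine (meas_ge_le_lintegral_div hmeas.aemeasurable (ENNReal.ofReal_pos.2 hAR).ne'
      ENNReal.ofReal_ne_top).trans (ENNReal.div_le_of_le_mul (hinterf.trans ?_))
    rw [ENNReal.ofReal_mul (by positivity), ENNReal.ofReal_natCast, mul_left_comm]
    gcongr
  have hdist : P {ω | δ ≤ ‖H 0 k ω‖ ∧ ‖H 0 k ω‖ ≤ D} =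
      P {ω | δ ≤ ‖H 0 0 ω‖ ∧ ‖H 0 0 ω‖ ≤ D} :=
    ((hstat 0).identDistrib k).measure_mem_eq (s := {z : ℂ | δ ≤ ‖z‖ ∧ ‖z‖ ≤ D})
      ((measurableSet_le measurable_const measurable_norm).inter
        (measurableSet_le measurable_norm measurable_const))
  -- The `+ 1` in the exponent of `amplitude` puts even the lowest level a factor `Γ` above the
  -- scale `A`.
  have hxk : (Γ : ℝ) * A ≤ ‖x k‖ := by
    obtain ⟨j, hj⟩ := hx k
    rw [hj, amplitude, if_pos hk, Complex.norm_natCast]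
    norm_cast
    rw [hA, ← pow_succ']
    exact Nat.pow_le_pow_right hΓ (by omega)
  simp only [output_eq]
  exact le_measure_levelSet P hq hδ (by exact_mod_cast hA1) hΓR hR hxk
    (hgood.trans hdist.ge) hw (hz k)

theorem exists_le_capacity (P : Measure Ω) [IsProbabilityMeasure P]
    {H : ℕ → ℕ → Ω → ℂ} {Z : ℕ → Ω → ℂ} (hH : ∀ ℓ k, Measurable (H ℓ k))
    (hZ : ∀ k, Measurable (Z k)) (hZ_law : ∀ k, P.map (Z k) = P.map (Z 0))
    (hstat : ∀ ℓ, IsStationary P (H ℓ)) (hpos : 0 < pathVariance P (H 0))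
    (hfin : ∀ ℓ, pathVariance P (H ℓ) ≠ ⊤)
    (hdecay : Tendsto (fun ℓ : ℕ => 1 / (ℓ : EReal) * ENNReal.log (1 / pathVariance P (H ℓ)))
      atTop (𝓝 ⊤)) (r : ℝ≥0) :
    ∃ Pow : ℝ≥0, 0 < Pow ∧ (r : ℝ≥0∞) ≤ capacity P H Z Pow := by
  obtain ⟨δ, D, hδ, hprob⟩ := exists_pos_measure_norm_mem P hpos
  set q : ℝ≥0∞ := P {ω | δ ≤ ‖H 0 0 ω‖ ∧ ‖H 0 0 ω‖ ≤ D} / 3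
  have hq0 : 0 < q := ENNReal.div_pos hprob.ne' (by simp)
  have hqtop : q ≠ ⊤ := ENNReal.div_ne_top (measure_ne_top _ _) (by simp)
  have hgood : 3 * q ≤ P {ω | δ ≤ ‖H 0 0 ω‖ ∧ ‖H 0 0 ω‖ ≤ D} := ENNReal.mul_div_le
  obtain ⟨R₀, hR₀, hRz⟩ := exists_measure_norm_ge_le P (hZ 0) hq0
  have hS : ∑' ℓ, pathMean P (H ℓ) + 1 ≠ ⊤ := by
    refine ENNReal.add_ne_top.2 ⟨?_, ENNReal.one_ne_top⟩
    simpa using tsum_pow_mul_pathMean_ne_top P hH hfin hdecay 1 le_rfl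
  -- The first entry controls the noise, the second makes Markov's bound on the interference at most
  -- `q`.
  set R : ℝ := max R₀ ((∑' ℓ, pathMean P (H ℓ) + 1) / q).toReal
  have hR : 0 < R := hR₀.trans_le (le_max_left _ _)
  have hz : ∀ k, P {ω | R ≤ ‖Z k ω‖} ≤ q := fun k => by
    have hset : MeasurableSet {z : ℂ | R ≤ ‖z‖} := measurableSet_le measurable_const measurable_norm
    have h := congrArg (fun μ => μ {z : ℂ | R ≤ ‖z‖}) (hZ_law k)
    simp only [Measure.map_apply (hZ _) hset] at h
    exact h.le.trans (hRz R (le_max_left _ _))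
  have hRq : ∑' ℓ, pathMean P (H ℓ) + 1 ≤ q * ENNReal.ofReal R := by
    rw [mul_comm]
    refine (ENNReal.div_le_iff hq0.ne' hqtop).1 ?_
    rw [← ENNReal.ofReal_toReal (ENNReal.div_ne_top hS hq0.ne')]
    exact ENNReal.ofReal_le_ofReal (le_max_right _ _)
  -- `4 * R / δ` lets the direct path dominate; `(D + δ) / (δ / 2)` makes the level sets of distinct
  -- amplitudes disjoint.
  obtain ⟨Γ, hΓ⟩ := exists_nat_ge (max 1 (max (4 * R / δ) ((D + δ) / (δ / 2))))
  have hΓ1 : 1 ≤ Γ := by exact_mod_cast (le_max_left _ _).trans hΓ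
  have hΓR : 4 * R ≤ δ * Γ := by
    have := ((le_max_left _ _).trans (le_max_right _ _)).trans hΓ
    rwa [div_le_iff₀' hδ] at this
  have hΓD : D + δ ≤ δ / 2 * Γ := by
    have := ((le_max_right _ _).trans (le_max_right _ _)).trans hΓ
    rwa [div_le_iff₀' (by positivity)] at this
  have hqr : 0 < q.toReal := ENNReal.toReal_pos hq0.ne' hqtop
  -- The target is `2 * r` because only half of the instants are guaranteed active. `L` is chosen
  -- last, as it depends on `Γ ^ N`.
  obtain ⟨N, hN, hN0⟩ : ∃ N : ℕ, (2 * r + Real.log 2) / q.toReal ≤ Real.log (1 + N) ∧ 0 < N := by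
    have ht : Tendsto (fun N : ℕ => Real.log (1 + N)) atTop atTop :=
      Real.tendsto_log_atTop.comp (tendsto_atTop_add_const_left _ _ tendsto_natCast_atTop_atTop)
    exact ((ht.eventually_ge_atTop _).and (eventually_gt_atTop 0)).exists
  rw [div_le_iff₀ hqr] at hN
  have : NeZero N := ⟨hN0.ne'⟩
  obtain ⟨L, hL, htail⟩ := exists_pow_mul_tsum_pathMean_le_one P hH hfin hdecay (Γ ^ N)
    (Nat.one_le_pow _ _ hΓ1)
  have hr : (0 : ℝ) ≤ r := r.coe_nonneg
  refine ⟨((Γ ^ (N * L)) ^ 2 : ℕ), by exact_mod_cast (by positivity),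
    le_liminf_of_le (by isBoundedDefault) ?_⟩
  filter_upwards [eventually_gt_atTop 0] with n hn
  rw [ENNReal.le_div_iff_mul_le (by simp [hn.ne']) (by simp)]
  refine le_trans ?_ (le_iSup₂_of_le _ (pi_symbolLaw_mem_admissibleInputs Γ L N n hΓ1)
    (le_mutualInfo_of_detection P hH hZ (q := q.toReal) hL (half_pos hδ) hΓD hΓ1
      (by linarith) n fun x hx k hk => ?_))
  · rw [← ENNReal.ofReal_coe_nnreal, ← ENNReal.ofReal_natCast n, ← ENNReal.ofReal_mul hr]
    refine ENNReal.ofReal_le_ofReal ?_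
    have hn' : (0 : ℝ) ≤ n := by positivity
    nlinarith
  · rw [ENNReal.ofReal_toReal hqtop]
    exact le_measure_output_mem_levelSet P hH hstat hqtop hδ hR hgood hz hRq hΓ1 hΓR htail x hx k hk

end Multipath

theorem theorem2 {Ω : Type*} [MeasurableSpace Ω] (P : Measure Ω) [IsProbabilityMeasure P]
    (σ : ℝ≥0) (hσ : 0 < σ)
    (H : ℕ → ℕ → Ω → ℂ) (Z : ℕ → Ω → ℂ)
    (hH_meas : ∀ ℓ k, Measurable (H ℓ k)) (hZ_meas : ∀ k, Measurable (Z k))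
    -- the noise is IID, zero-mean, circularly-symmetric complex Gaussian of variance `σ ^ 2`
    (hZ_law : ∀ k, P.map (Z k) = Multipath.complexGaussian (σ ^ 2))
    (hZ_indep : iIndepFun Z P)
    -- the path gains are zero-mean stationary processes
    (hH_mean : ∀ ℓ k, ∫ ω, H ℓ k ω ∂P = 0)
    (hH_stat : ∀ ℓ, Multipath.IsStationary P (H ℓ))
    -- assumptions on the variances and on the entropy rates
    (hα_zero : 0 < Multipath.pathVariance P (H 0))
    (hα_sum : ∑' ℓ, Multipath.pathVariance P (H ℓ) < ⊤)
    (hh : ∀ ℓ, 0 < Multipath.pathVariance P (H ℓ) → ⊥ < Multipath.entropyRate P (H ℓ))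
    -- the paths are independent, and jointly independent of the noise
    (hH_indep : iIndepFun (fun ℓ ω k => H ℓ k ω) P)
    (hHZ_indep : IndepFun (fun ω ℓ k => H ℓ k ω) (fun ω k => Z k ω) P)
    -- the path variances decay faster than exponentially
    (hdecay : Tendsto
      (fun ℓ : ℕ => 1 / (ℓ : EReal) * ENNReal.log (1 / Multipath.pathVariance P (H ℓ)))
      atTop (𝓝 ⊤)) :
    (⨆ (snr : ℝ≥0) (_ : 0 < snr), Multipath.capacity P H Z (snr * σ ^ 2)) = (⊤ : ℝ≥0∞) := by
  refine ENNReal.eq_top_of_forall_nnreal_le fun r => ?_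
  obtain ⟨Pow, hPow, hle⟩ := Multipath.exists_le_capacity P hH_meas hZ_meas
    (fun k => (hZ_law k).trans (hZ_law 0).symm) hH_stat hα_zero
    (fun ℓ => ((ENNReal.le_tsum ℓ).trans_lt hα_sum).ne) hdecay r
  have hσ2 : 0 < σ ^ 2 := pow_pos hσ 2
  refine le_iSup₂_of_le (Pow / σ ^ 2) (div_pos hPow hσ2) ?_
  rwa [div_mul_cancel₀ Pow hσ2.ne']
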